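/- A finite noncompact graph $\mathcal G=(V,\mathcal I,\mathcal E,\partial)$ consists of a finite set $V$ of vertices, a finite set $\mathcal I$ of internal edges, a finite set $\mathcal E$ of external edges, and a map $\partial$ that assigns to every $i\in\mathcal I$ an ordered pair of (possibly equal) end vertices and to every $e\in\mathcal E$ a single vertex $\partial(e)$; distinct edges may have the same end vertices. A metric graph $(\mathcal G,\underline a)$ is such a graph together with lengths $a_i>0$, $i\in\mathcal I$. Its interior is $\mathcal G_{\mathrm{int}}=(V,\mathcal I,\emptyset,\partial|_{\mathcal I})$. A walk from $e'\in\mathcal E$ to $e\in\mathcal E$ is a sequence $(e',i_1,\dots,i_N,e)$, $N\ge 0$, with $i_k\in\mathcal I$, for which there are vertices $v_0=\partial(e'),v_1,\dots,v_N=\partial(e)$ such that for each $k=1,\dots,N$ the end vertices of $i_k$ are $v_{k-1}$ and $v_k$ (in either order). Its metric length is $\sum_{k=1}^N a_{i_k}$, and $\mathcal L_{e,e'}$ denotes the set of the metric lengths of all walks from $e'$ to $e$. **Theorem.** Let $(\mathcal G,\underline a)$ and $(\mathcal G',\underline a')$ be metric graphs, each of which satisfies: (i) the graph is connected (through internal edges),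 has at least one external edge, and has no tadpoles, i.e. no internal edge whose two end vertices coincide; (ii) the lengths of its internal edges are rationally independent, i.e. $\sum_{i} n_i a_i=0$ with $n_i\in\mathbb Z$ implies that all $n_i=0$. Let $e$ and $e'$ be arbitrary external edges of $\mathcal G$ and $\mathcal G'$, respectively. If $\mathcal L_{e,e}(\mathcal G,\underline a)=\mathcal L_{e',e'}(\mathcal G',\underline a')$, then there are bijections $V\to V'$ and $\mathcal I\to\mathcal I'$ that carry $\mathcal G_{\mathrm{int}}$ to $\mathcal G'_{\mathrm{int}}$ (the pair of end vertices of each internal edge goes to the pair of end vertices of its image, up to orientation), carry $\partial(e)$ to $\partial(e')$, and preserve the edge lengths. In other words, the set $\mathcal L_{e,e}$ uniquely determines the interior graph $\mathcal G_{\mathrm{int}}$ (up to the names of vertices and edges and the orientations of the edges), the vertex $\partial(e)$ and the metric $\underline a$. -/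

import Mathlib

/-- A graph `(V, I, E, ∂)` with vertex set `V`, internal edges `I` and external edges `E`.
Each internal edge has an ordered pair of (possibly equal) end vertices, each external edge has a
single vertex. Parallel internal edges are allowed. (Finiteness is imposed on the types.) -/
structure OpenGraph (V I E : Type*) where
  /-- the initial vertex of an internal edge -/
  init : I → V
  /-- the terminal vertex of an internal edge -/
  term : I → V
  /-- the vertex of an external edge -/
  bd : E → V

namespace OpenGraph

variable {V I E : Type*}

/-- The vertex `v` is incident with the internal edge `i`. -/
def Inc (G : OpenGraph V I E) (v : V) (i : I) : Prop := v = G.init i ∨ v = G.term i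

/-- An internal edge is a tadpole if its two end vertices coincide. -/
def IsTadpole (G : OpenGraph V I E) (i : I) : Prop := G.init i = G.term i

/-- Two vertices are adjacent if some internal edge is incident with both. -/
def Adj (G : OpenGraph V I E) (v w : V) : Prop := ∃ i : I, G.Inc v i ∧ G.Inc w i

/-- Any two vertices are joined by a sequence of successively adjacent vertices. -/
def Connected (G : OpenGraph V I E) : Prop := ∀ v w : V, Relation.ReflTransGen G.Adj v w

/-- No internal edge is a tadpole. -/
def NoTadpoles (G : OpenGraph V I E) : Prop := ∀ i : I, ¬ G.IsTadpole i

/-- `G.Joins u [i₁, …, i_N] w`: there are vertices `v₀ = u, v₁, …, v_N = w` such that, for every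
`k = 1, …, N`, both `v_{k-1}` and `v_k` are incident with `i_k`, and `v_{k-1} = v_k` if and only if
`i_k` is a tadpole. -/
def Joins (G : OpenGraph V I E) : V → List I → V → Prop
  | u, [], w => u = w
  | u, i :: l, w => ∃ v : V, G.Inc u i ∧ G.Inc v i ∧ (u = v ↔ G.IsTadpole i) ∧ G.Joins v l w

/-- `(e', i₁, …, i_N, e)` is a walk from the external edge `e'` to the external edge `e`.
For `N = 0` this is the trivial walk, which exists if and only if `∂(e') = ∂(e)`. -/
def IsWalk (G : OpenGraph V I E) (e' : E) (l : List I) (e : E) : Prop :=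
  G.Joins (G.bd e') l (G.bd e)

end OpenGraph

/-- A metric graph: a graph together with a positive length for every internal edge. -/
structure MetricOpenGraph (V I E : Type*) extends OpenGraph V I E where
  /-- the length of an internal edge -/
  len : I → ℝ
  len_pos : ∀ i : I, 0 < len i

namespace MetricOpenGraph

variable {V I E V' I' E' : Type*}

/-- The interior of a metric graph: all external edges are removed. -/
def interior (G : MetricOpenGraph V I E) : MetricOpenGraph V I Empty where
  init := G.init
  term := G.term
  bd := Empty.elim
  len := G.len
  len_pos := G.len_pos

/-- The only integer solution of `∑ i, n i * a i = 0` is the trivial one. -/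
def RationallyIndependent [Fintype I] (G : MetricOpenGraph V I E) : Prop :=
  ∀ n : I → ℤ, ∑ i : I, (n i : ℝ) * G.len i = 0 → ∀ i : I, n i = 0

/-- The set of metric lengths `a_{i₁} + ⋯ + a_{i_N}` of all walks from `e'` to `e`
(with repeated edges counted each time, and the trivial walk included if there is one). -/
def walkLengths (G : MetricOpenGraph V I E) (e e' : E) : Set ℝ :=
  {x : ℝ | ∃ l : List I, G.IsWalk e' l e ∧ x = (l.map G.len).sum}

/-- An isomorphism of metric graphs: bijections of vertices, internal edges and external edges that
respect incidence (internal edges up to orientation) and the lengths. -/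
structure Iso (G : MetricOpenGraph V I E) (G' : MetricOpenGraph V' I' E') where
  onV : V ≃ V'
  onI : I ≃ I'
  onE : E ≃ E'
  ends : ∀ i : I,
    (G'.init (onI i) = onV (G.init i) ∧ G'.term (onI i) = onV (G.term i)) ∨
    (G'.init (onI i) = onV (G.term i) ∧ G'.term (onI i) = onV (G.init i))
  bd_eq : ∀ e : E, G'.bd (onE e) = onV (G.bd e)
  len_eq : ∀ i : I, G'.len (onI i) = G.len i

end MetricOpenGraph

/-! ### Walks: concatenation, reversal, existence. -/

namespace OpenGraph

open Finsupp

variable {V I E V' I' E' : Type*}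

/-! Rational independence makes a length determine how often a walk uses each edge. The directions
in which the monoid of closed walk lengths can grow forever contain every `2 * len i` (run back and
forth on `i`) but no `len i`, since a lone edge that is no tadpole is not a cycle modulo two. Hence
the doubled lengths are the extremal elements (`isExtremal_recession_iff`), and the edges of the two
graphs can be identified by length.

Closed walks at the two roots then agree up to the order of edges. Simple paths from one root are,
edge by edge, simple paths from the other (`exists_extension`). Vertices reached by the same path
are matched; this is well defined because two paths with a common end differ by a cycle modulo two,
and such cycles transfer (`SamePath.eq_of_eq`). Every edge ends some simple path, so incidence is
respected (`exists_equiv`). -/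

theorem Joins.append {G : OpenGraph V I E} :
    ∀ {l₁ l₂ : List I} {u v w : V}, G.Joins u l₁ v → G.Joins v l₂ w → G.Joins u (l₁ ++ l₂) w
  | [], _, _, _, _, h₁, h₂ => by
    cases h₁
    exact h₂
  | _ :: _, _, _, _, _, ⟨x, hu, hx, hux, h⟩, h₂ => ⟨x, hu, hx, hux, Joins.append h h₂⟩

theorem joins_singleton {G : OpenGraph V I E} (hG : G.NoTadpoles) {i : I} {u v : V}
    (hu : G.Inc u i) (hv : G.Inc v i) (huv : u ≠ v) : G.Joins u [i] v :=
  ⟨v, hu, hv, iff_of_false huv (hG i), rfl⟩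

theorem Joins.reverse {G : OpenGraph V I E} :
    ∀ {l : List I} {u w : V}, G.Joins u l w → G.Joins w l.reverse u
  | [], _, _, h => Eq.symm h
  | i :: l, u, w, ⟨x, hu, hx, hux, h⟩ => by
    rw [List.reverse_cons]
    exact (Joins.reverse h).append ⟨u, hx, hu, by rw [eq_comm, hux], rfl⟩

theorem inc_init (G : OpenGraph V I E) (i : I) : G.Inc (G.init i) i := Or.inl rfl

theorem inc_term (G : OpenGraph V I E) (i : I) : G.Inc (G.term i) i := Or.inr rfl

theorem Connected.exists_joins {G : OpenGraph V I E} (hc : G.Connected) (hG : G.NoTadpoles)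
    (u v : V) : ∃ l, G.Joins u l v := by
  induction hc u v with
  | refl => exact ⟨[], rfl⟩
  | @tail x y _ hxy ih =>
    obtain ⟨l, hl⟩ := ih
    obtain ⟨i, hx, hy⟩ := hxy
    by_cases h : x = y
    · exact ⟨l, h ▸ hl⟩
    · exact ⟨l ++ [i], hl.append (joins_singleton hG hx hy h)⟩

/-! ### The boundary modulo two -/

/-- The number of passages through every edge, modulo two. -/
noncomputable def parity (l : List I) : I →₀ ZMod 2 := (l.map fun i => single i 1).sum

/-- The boundary operator from edges to vertices with coefficients modulo two. -/
noncomputable def boundary (G : OpenGraph V I E) : (I →₀ ZMod 2) →ₗ[ZMod 2] (V →₀ ZMod 2) :=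
  Finsupp.linearCombination (ZMod 2) fun i => single (G.init i) 1 + single (G.term i) 1

theorem finsupp_zmod_two_add_self {α : Type*} (x : α →₀ ZMod 2) : x + x = 0 := by
  ext a
  exact CharTwo.add_self_eq_zero (x a)

theorem parity_append (l₁ l₂ : List I) : parity (l₁ ++ l₂) = parity l₁ + parity l₂ := by
  simp [parity]

theorem parity_cons (i : I) (l : List I) : parity (i :: l) = single i 1 + parity l := by
  simp [parity]

theorem parity_perm {l₁ l₂ : List I} (h : l₁.Perm l₂) : parity l₁ = parity l₂ :=
  (h.map _).sum_eq

theorem parity_reverse (l : List I) : parity l.reverse = parity l :=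
  parity_perm l.reverse_perm

theorem boundary_single {G : OpenGraph V I E} {i : I} {u v : V} (hu : G.Inc u i) (hv : G.Inc v i)
    (huv : u ≠ v) : G.boundary (single i 1) = single u 1 + single v 1 := by
  simp only [boundary, linearCombination_single, one_smul]
  rcases hu with rfl | rfl <;> rcases hv with rfl | rfl
  · exact absurd rfl huv
  · rfl
  · exact add_comm _ _
  · exact absurd rfl huv

/-- Intermediate vertices cancel in pairs, so the ends survive any reordering of the edges. -/
theorem Joins.boundary_parity {G : OpenGraph V I E} (hG : G.NoTadpoles) :
    ∀ {l : List I} {u w : V}, G.Joins u l w →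
      G.boundary (parity l) = single u 1 + single w 1
  | [], u, w, h => by
    cases h
    simp [parity, finsupp_zmod_two_add_self]
  | i :: l, u, w, ⟨x, hu, hx, hux, h⟩ => by
    rw [parity_cons, map_add, Joins.boundary_parity hG h,
      boundary_single hu hx fun h' => hG i (hux.1 h')]
    rw [add_assoc, ← add_assoc (single x 1), finsupp_zmod_two_add_self, zero_add]

theorem single_add_single_eq_zero_iff {u v : V} :
    (single u 1 + single v 1 : V →₀ ZMod 2) = 0 ↔ u = v := by
  constructor
  · intro h
    have h2 : (single u 1 : V →₀ ZMod 2) = single v 1 := by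
      have := congrArg (· + (single v 1 : V →₀ ZMod 2)) h
      simpa [add_assoc, finsupp_zmod_two_add_self] using this
    exact Finsupp.single_left_injective one_ne_zero h2
  · rintro rfl
    exact finsupp_zmod_two_add_self _

/-- Every cycle modulo two is the parity of a closed walk through a given vertex. -/
theorem boundary_eq_zero_iff {G : OpenGraph V I E} (hc : G.Connected) (hG : G.NoTadpoles) (r : V)
    (x : I →₀ ZMod 2) : G.boundary x = 0 ↔ ∃ l, G.Joins r l r ∧ parity l = x := by
  constructor
  · intro hx
    choose p hp using fun v => hc.exists_joins hG r v
    let q : (V →₀ ZMod 2) →ₗ[ZMod 2] (I →₀ ZMod 2) :=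
      Finsupp.linearCombination (ZMod 2) fun v => parity (p v)
    -- Each edge is closed up through `r` by the chosen paths `p`, whose total contribution is `q
    -- (G.boundary y)`; it vanishes for cycles.
    have key : ∀ y : I →₀ ZMod 2, ∃ l, G.Joins r l r ∧ parity l = y + q (G.boundary y) := by
      intro y
      induction y using Finsupp.induction_linear with
      | zero => exact ⟨[], rfl, by simp [parity]⟩
      | add f g hf hg =>
        obtain ⟨l₁, h₁, e₁⟩ := hf
        obtain ⟨l₂, h₂, e₂⟩ := hg
        refine ⟨l₁ ++ l₂, h₁.append h₂, ?_⟩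
        rw [parity_append, e₁, e₂, map_add, map_add]
        abel
      | single i c =>
        have hcases : ∀ c : ZMod 2, c = 0 ∨ c = 1 := by decide
        rcases hcases c with rfl | rfl
        · exact ⟨[], rfl, by simp [parity]⟩
        · refine ⟨p (G.init i) ++ ([i] ++ (p (G.term i)).reverse),
            (hp _).append ((joins_singleton hG (G.inc_init i) (G.inc_term i) (hG i)).append
              (hp _).reverse), ?_⟩
          rw [boundary_single (G.inc_init i) (G.inc_term i) (hG i)]
          simp only [parity_append, parity_reverse, map_add, q, linearCombination_single, one_smul]
          simp only [parity, List.map_cons, List.map_nil, List.sum_cons, List.sum_nil, add_zero]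
          abel
    obtain ⟨l, hl, e⟩ := key x
    exact ⟨l, hl, by rw [e, hx, map_zero, add_zero]⟩
  · rintro ⟨l, hl, rfl⟩
    rw [hl.boundary_parity hG, finsupp_zmod_two_add_self]

/-! ### Simple paths from a root -/

/-- `G.SimplePath r l vs`: the edges `l` (last one first) form a path from `r` that visits the
pairwise distinct vertices `vs` (last one first). -/
inductive SimplePath (G : OpenGraph V I E) (r : V) : List I → List V → Prop
  | nil : SimplePath G r [] [r]
  | cons {l : List I} {i : I} {u v : V} {vs : List V} :
      SimplePath G r l (u :: vs) → G.Inc u i → G.Inc v i → v ∉ u :: vs →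
        SimplePath G r (i :: l) (v :: u :: vs)

namespace SimplePath

variable {G : OpenGraph V I E} {r : V} {l : List I} {vs : List V}

theorem nodup (h : G.SimplePath r l vs) : vs.Nodup := by
  induction h with
  | nil => simp
  | cons _ _ _ hv ih => exact List.nodup_cons.2 ⟨hv, ih⟩

theorem joins (hG : G.NoTadpoles) {l : List I} {vs : List V} (h : G.SimplePath r l vs) :
    ∀ {v : V} {ws : List V}, vs = v :: ws → G.Joins r l.reverse v := by
  induction h with
  | nil =>
    intro v ws h
    cases h
    exact rfl
  | cons _ hu hv hne ih =>
    intro v ws h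
    cases h
    rw [List.reverse_cons]
    exact (ih rfl).append (joins_singleton hG hu hv fun h => hne (h ▸ List.mem_cons_self))

theorem mem_of_inc (h : G.SimplePath r l vs) {i : I} {x : V} (hi : i ∈ l)
    (hx : G.Inc x i) : x ∈ vs := by
  induction h with
  | nil => simp at hi
  | @cons l j u v vs _ hu hv hne ih =>
    rcases List.mem_cons.1 hi with rfl | hi
    · have huv : u ≠ v := fun h => hne (h ▸ List.mem_cons_self)
      rcases hu with hu | hu <;> rcases hv with hv | hv <;> rcases hx with hx | hx <;> simp_all
    · exact List.mem_cons_of_mem _ (ih hi)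

/-- A walk that uses only one edge `i` besides the edges of a path meets the path in an end vertex
of `i`. -/
theorem exists_inc (hG : G.NoTadpoles) (h : G.SimplePath r l vs) {i : I} :
    ∀ {w : List I} {u x : V}, G.Joins u w x → u ∈ vs → (∀ j ∈ w, j = i ∨ j ∈ l) → i ∈ w →
      ∃ y ∈ vs, G.Inc y i
  | [], _, _, _, _, _, hi => by simp at hi
  | j :: w, u, _, ⟨y, hu, hy, _, hw⟩, huvs, hsub, hi => by
    by_cases hji : j = i
    · exact ⟨u, huvs, hji ▸ hu⟩
    · have hjl : j ∈ l := (hsub j List.mem_cons_self).resolve_left hji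
      refine exists_inc hG h hw (h.mem_of_inc hjl hy)
        (fun k hk => hsub k (List.mem_cons_of_mem _ hk)) ?_
      exact (List.mem_cons.1 hi).resolve_left fun h => hji h.symm

theorem length (h : G.SimplePath r l vs) : vs.length = l.length + 1 := by
  induction h with
  | nil => rfl
  | cons _ _ _ _ ih => exact congrArg (· + 1) ih

theorem root_mem (h : G.SimplePath r l vs) : r ∈ vs := by
  induction h with
  | nil => simp
  | cons _ _ _ _ ih => exact List.mem_cons_of_mem _ ih

/-- Vertices are listed last one first, so an initial part of the path is a suffix. -/
theorem truncate (h : G.SimplePath r l vs) {x : V} (hx : x ∈ vs) :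
    ∃ t ts, G.SimplePath r t (x :: ts) ∧ (x :: ts) <:+ vs := by
  induction h with
  | nil =>
    obtain rfl := List.mem_singleton.1 hx
    exact ⟨_, _, .nil, List.suffix_rfl⟩
  | @cons l i u v vs h hu hv hne ih =>
    rcases List.mem_cons.1 hx with rfl | hx
    · exact ⟨_, _, .cons h hu hv hne, List.suffix_rfl⟩
    · obtain ⟨t, ts, ht, hs⟩ := ih hx
      exact ⟨t, ts, ht, hs.trans (List.suffix_cons _ _)⟩

/-- Two rooted paths with the same edges can be truncated simultaneously. -/
theorem truncate_pair {G' : OpenGraph V' I E'} {r' : V'} {l : List I} {vs : List V}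
    (h : G.SimplePath r l vs) : ∀ {vs' : List V'}, G'.SimplePath r' l vs' → ∀ {x' : V'}, x' ∈ vs' →
      ∃ t x ts ts', G.SimplePath r t (x :: ts) ∧ G'.SimplePath r' t (x' :: ts') ∧
        (x :: ts) <:+ vs ∧ (x' :: ts') <:+ vs' := by
  induction h with
  | nil =>
    rintro _ ⟨⟩ x' hx
    obtain rfl := List.mem_singleton.1 hx
    exact ⟨_, _, _, _, .nil, .nil, List.suffix_rfl, List.suffix_rfl⟩
  | @cons l i u v vs h hu hv hne ih =>
    rintro _ (_ | ⟨h', hu', hv', hne'⟩) x' hx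
    rcases List.mem_cons.1 hx with rfl | hx
    · exact ⟨_, _, _, _, .cons h hu hv hne, .cons h' hu' hv' hne', List.suffix_rfl,
        List.suffix_rfl⟩
    · obtain ⟨t, x, ts, ts', ht, ht', hs, hs'⟩ := ih h' hx
      exact ⟨t, x, ts, ts', ht, ht', hs.trans (List.suffix_cons _ _),
        hs'.trans (List.suffix_cons _ _)⟩

end SimplePath

theorem Connected.exists_simplePath {G : OpenGraph V I E} (hc : G.Connected) (r v : V) :
    ∃ l vs, G.SimplePath r l (v :: vs) := by
  induction hc r v with
  | refl => exact ⟨_, _, .nil⟩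
  | @tail x y _ hxy ih =>
    obtain ⟨l, vs, h⟩ := ih
    obtain ⟨i, hx, hy⟩ := hxy
    by_cases hmem : y ∈ x :: vs
    · obtain ⟨t, ts, ht, -⟩ := h.truncate hmem
      exact ⟨t, ts, ht⟩
    · exact ⟨_, _, h.cons hx hy hmem⟩

/-- Every edge is the last edge of a simple path from the root. -/
theorem Connected.exists_simplePath_cons {G : OpenGraph V I E} (hc : G.Connected)
    (hG : G.NoTadpoles) (r : V) (i : I) :
    ∃ l u v vs, G.SimplePath r l (u :: vs) ∧ G.Inc u i ∧ G.Inc v i ∧ v ∉ u :: vs := by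
  obtain ⟨l, vs, h⟩ := hc.exists_simplePath r (G.init i)
  -- If the far end already lies on the path, stop there and traverse `i` backwards: `G.init i`
  -- ended the path, so the truncation misses it.
  by_cases hmem : G.term i ∈ G.init i :: vs
  · obtain ⟨t, ts, ht, hs⟩ := h.truncate hmem
    refine ⟨t, _, _, ts, ht, G.inc_term i, G.inc_init i, fun hm => ?_⟩
    rcases List.suffix_cons_iff.1 hs with he | hs'
    · exact hG i (List.cons.inj he).1.symm
    · exact (List.nodup_cons.1 h.nodup).1 (hs'.subset hm)
  · exact ⟨l, _, _, vs, h, G.inc_init i, G.inc_term i, hmem⟩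

/-! ### Comparing two graphs with the same edges -/

/-- Every closed walk of `G` through `r` is a rearrangement of one of `G'` through `r'`. -/
def ClosedWalksPerm (G : OpenGraph V I E) (r : V) (G' : OpenGraph V' I E') (r' : V') : Prop :=
  ∀ l, G.Joins r l r → ∃ l', G'.Joins r' l' r' ∧ l'.Perm l

/-- The vertices `v` and `v'` are the ends of simple paths from the roots with the same edges. -/
def SamePath (G : OpenGraph V I E) (r : V) (G' : OpenGraph V' I E') (r' : V') (v : V) (v' : V') :
    Prop :=
  ∃ l vs vs', G.SimplePath r l (v :: vs) ∧ G'.SimplePath r' l (v' :: vs')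

section Compare

variable {G : OpenGraph V I E} {G' : OpenGraph V' I E'} {r : V} {r' : V'}

theorem SamePath.symm {v : V} {v' : V'} (h : SamePath G r G' r' v v') :
    SamePath G' r' G r v' v := by
  obtain ⟨l, vs, vs', h₁, h₂⟩ := h
  exact ⟨l, vs', vs, h₂, h₁⟩

/-- Going out and back closes any walk, so the edge sets of all rooted walks transfer. -/
theorem ClosedWalksPerm.exists_joins (hS : ClosedWalksPerm G r G' r') {l : List I} {w : V}
    (h : G.Joins r l w) : ∃ l', G'.Joins r' l' r' ∧ ∀ i, i ∈ l' ↔ i ∈ l := by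
  obtain ⟨l', h', hp⟩ := hS _ (h.append h.reverse)
  exact ⟨l', h', fun i => by simp [hp.mem_iff]⟩

theorem ClosedWalksPerm.boundary_eq_zero (hS : ClosedWalksPerm G r G' r') (hc : G.Connected)
    (hG : G.NoTadpoles) (hG' : G'.NoTadpoles) {x : I →₀ ZMod 2} (hx : G.boundary x = 0) :
    G'.boundary x = 0 := by
  obtain ⟨l, hl, rfl⟩ := (boundary_eq_zero_iff hc hG r x).1 hx
  obtain ⟨l', hl', hp⟩ := hS l hl
  rw [← parity_perm hp, hl'.boundary_parity hG', finsupp_zmod_two_add_self]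

theorem boundary_parity_add (hG : G.NoTadpoles) {l₁ l₂ : List I} {v w : V} {vs ws : List V}
    (h₁ : G.SimplePath r l₁ (v :: vs)) (h₂ : G.SimplePath r l₂ (w :: ws)) :
    G.boundary (parity l₁ + parity l₂) = single v 1 + single w 1 := by
  rw [← parity_reverse l₁, ← parity_append]
  have h := (h₁.joins hG rfl).reverse.append (h₂.joins hG rfl)
  rw [List.reverse_reverse] at h
  rw [← h.boundary_parity hG, parity_append, parity_append, parity_reverse, parity_reverse]

theorem SamePath.eq_of_eq (hS : ClosedWalksPerm G r G' r') (hc : G.Connected)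
    (hG : G.NoTadpoles) (hG' : G'.NoTadpoles) {v : V} {v' w' : V'}
    (h₁ : SamePath G r G' r' v v') (h₂ : SamePath G r G' r' v w') : v' = w' := by
  obtain ⟨l₁, vs₁, vs₁', p₁, p₁'⟩ := h₁
  obtain ⟨l₂, vs₂, vs₂', p₂, p₂'⟩ := h₂
  rw [← single_add_single_eq_zero_iff, ← boundary_parity_add hG' p₁' p₂']
  apply hS.boundary_eq_zero hc hG hG'
  rw [boundary_parity_add hG p₁ p₂, finsupp_zmod_two_add_self]

/-- The extension of a path by an edge that leads to a new vertex is such an extension in both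
graphs. -/
theorem exists_extension (hS : ClosedWalksPerm G r G' r') (hS' : ClosedWalksPerm G' r' G r)
    (hG : G.NoTadpoles) (hG' : G'.NoTadpoles) {l : List I} {i : I} {u v : V} {vs : List V}
    {u' : V'} {vs' : List V'} (h : G.SimplePath r l (u :: vs)) (h' : G'.SimplePath r' l (u' :: vs'))
    (hu : G.Inc u i) (hv : G.Inc v i) (hne : v ∉ u :: vs) :
    ∃ v', G'.Inc u' i ∧ G'.Inc v' i ∧ v' ∉ u' :: vs' := by
  have huv : u ≠ v := fun h => hne (h ▸ List.mem_cons_self)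
  have hends : ∀ x, G.Inc x i → x = u ∨ x = v := by
    intro x hx
    rcases hu with hu | hu <;> rcases hv with hv | hv <;> rcases hx with hx | hx <;> simp_all
  -- If `i` met the path of `G'` before its end, a truncated path `t` followed by `i` would be a
  -- walk there. Its edge set transfers to `G`, where `i` must meet the path of `t`; but `i` meets
  -- the full path only at its end `u`, so nothing was truncated.
  have hold : ∀ x' ∈ u' :: vs', G'.Inc x' i → x' = u' := by
    intro x' hx' hi
    obtain ⟨t, x, ts, ts', ht, ht', hs, hs'⟩ := h.truncate_pair h' hx'
    obtain ⟨y', hy', hyne⟩ : ∃ y', G'.Inc y' i ∧ x' ≠ y' := by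
      rcases hi with hi | hi
      · exact ⟨_, G'.inc_term i, hi ▸ hG' i⟩
      · exact ⟨_, G'.inc_init i, hi ▸ Ne.symm (hG' i)⟩
    obtain ⟨w, hw, hmem⟩ := hS'.exists_joins
      ((ht'.joins hG' rfl).append (joins_singleton hG' hi hy' hyne))
    obtain ⟨y, hy, hyi⟩ := ht.exists_inc hG (i := i) hw ht.root_mem
      (fun j hj => by simpa [or_comm] using (hmem j).1 hj) ((hmem i).2 (by simp))
    have hyu : y = u := (hends y hyi).resolve_right fun hyv => hne (hyv ▸ hs.subset hy)
    subst hyu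
    have he : x :: ts = y :: vs := (List.suffix_cons_iff.1 hs).resolve_right fun hs =>
      (List.nodup_cons.1 h.nodup).1 (hs.subset hy)
    have hlen : (x' :: ts').length = (u' :: vs').length := by
      rw [ht'.length, h'.length, ← ht.length, ← h.length, he]
    exact (List.cons.inj (hs'.eq_of_length hlen)).1
  obtain ⟨w, hw, hmem⟩ := hS.exists_joins
    ((h.joins hG rfl).append (joins_singleton hG hu hv huv))
  obtain ⟨y', hy, hyi⟩ := h'.exists_inc hG' (i := i) hw h'.root_mem
    (fun j hj => by simpa [or_comm] using (hmem j).1 hj) ((hmem i).2 (by simp))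
  obtain rfl := hold y' hy hyi
  rcases hyi with hyi | hyi
  · refine ⟨_, Or.inl hyi, G'.inc_term i, fun hm => ?_⟩
    exact hG' i (hyi.symm.trans (hold _ hm (G'.inc_term i)).symm)
  · refine ⟨_, Or.inr hyi, G'.inc_init i, fun hm => ?_⟩
    exact hG' i ((hold _ hm (G'.inc_init i)).trans hyi)

theorem exists_simplePath_of_simplePath (hS : ClosedWalksPerm G r G' r')
    (hS' : ClosedWalksPerm G' r' G r) (hG : G.NoTadpoles) (hG' : G'.NoTadpoles) {l : List I}
    {vs : List V} (h : G.SimplePath r l vs) : ∃ v' vs', G'.SimplePath r' l (v' :: vs') := by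
  induction h with
  | nil => exact ⟨_, _, .nil⟩
  | cons h hu hv hne ih =>
    obtain ⟨u', vs', h'⟩ := ih
    obtain ⟨v', hu', hv', hne'⟩ := exists_extension hS hS' hG hG' h h' hu hv hne
    exact ⟨_, _, h'.cons hu' hv' hne'⟩

theorem exists_samePath (hS : ClosedWalksPerm G r G' r') (hS' : ClosedWalksPerm G' r' G r)
    (hc : G.Connected) (hG : G.NoTadpoles) (hG' : G'.NoTadpoles) (v : V) :
    ∃ v', SamePath G r G' r' v v' := by
  obtain ⟨l, vs, h⟩ := hc.exists_simplePath r v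
  obtain ⟨v', vs', h'⟩ := exists_simplePath_of_simplePath hS hS' hG hG' h
  exact ⟨v', l, vs, vs', h, h'⟩

/-- A path ending in `i` matches both ends of `i` at once, so edges outside a spanning tree need no
separate treatment. -/
theorem exists_samePath_inc (hS : ClosedWalksPerm G r G' r') (hS' : ClosedWalksPerm G' r' G r)
    (hc : G.Connected) (hG : G.NoTadpoles) (hG' : G'.NoTadpoles) (i : I) :
    ∃ u v u' v', SamePath G r G' r' u u' ∧ SamePath G r G' r' v v' ∧ G.Inc u i ∧ G.Inc v i ∧
      u ≠ v ∧ G'.Inc u' i ∧ G'.Inc v' i ∧ u' ≠ v' := by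
  obtain ⟨l, u, v, vs, h, hu, hv, hne⟩ := hc.exists_simplePath_cons hG r i
  obtain ⟨u', vs', h'⟩ := exists_simplePath_of_simplePath hS hS' hG hG' h
  obtain ⟨v', hu', hv', hne'⟩ := exists_extension hS hS' hG hG' h h' hu hv hne
  exact ⟨u, v, u', v', ⟨_, _, _, h, h'⟩, ⟨_, _, _, h.cons hu hv hne, h'.cons hu' hv' hne'⟩, hu, hv,
    fun e => hne (e ▸ List.mem_cons_self), hu', hv', fun e => hne' (e ▸ List.mem_cons_self)⟩

/-- Rooted connected graphs without tadpoles are isomorphic if their closed walks through the root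
agree up to the order of the edges. -/
theorem exists_equiv (hS : ClosedWalksPerm G r G' r') (hS' : ClosedWalksPerm G' r' G r)
    (hc : G.Connected) (hc' : G'.Connected) (hG : G.NoTadpoles) (hG' : G'.NoTadpoles) :
    ∃ φ : V ≃ V', φ r = r' ∧ ∀ i,
      (G'.init i = φ (G.init i) ∧ G'.term i = φ (G.term i)) ∨
      (G'.init i = φ (G.term i) ∧ G'.term i = φ (G.init i)) := by
  choose f hf using exists_samePath hS hS' hc hG hG'
  choose g hg using exists_samePath hS' hS hc' hG' hG
  have hfu : ∀ {v v'}, SamePath G r G' r' v v' → f v = v' := fun h =>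
    (hf _).eq_of_eq hS hc hG hG' h
  have hgu : ∀ {v v'}, SamePath G' r' G r v v' → g v = v' := fun h =>
    (hg _).eq_of_eq hS' hc' hG' hG h
  refine ⟨⟨f, g, fun v => hgu (hf v).symm, fun v => hfu (hg v).symm⟩,
    hfu ⟨_, _, _, .nil, .nil⟩, fun i => ?_⟩
  obtain ⟨u, v, u', v', h₁, h₂, hu, hv, huv, hu', hv', huv'⟩ :=
    exists_samePath_inc hS hS' hc hG hG' i
  have e₁ := hfu h₁
  have e₂ := hfu h₂
  simp only [Equiv.coe_fn_mk]
  rcases hu with hu | hu <;> rcases hv with hv | hv <;> rcases hu' with hu' | hu' <;>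
    rcases hv' with hv' | hv' <;> simp_all

end Compare

/-! ### Renaming edges -/

/-- The graph whose edges are renamed along a bijection. -/
def comapEdges (G : OpenGraph V I' E) (σ : I ≃ I') : OpenGraph V I E where
  init := G.init ∘ σ
  term := G.term ∘ σ
  bd := G.bd

theorem joins_comapEdges {G : OpenGraph V I' E} {σ : I ≃ I'} :
    ∀ {l : List I} {u w : V}, (G.comapEdges σ).Joins u l w ↔ G.Joins u (l.map σ) w
  | [], _, _ => Iff.rfl
  | _ :: _, _, _ => exists_congr fun _ =>
    and_congr Iff.rfl (and_congr Iff.rfl (and_congr Iff.rfl joins_comapEdges))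

theorem Connected.comapEdges {G : OpenGraph V I' E} (h : G.Connected) (σ : I ≃ I') :
    (G.comapEdges σ).Connected := by
  refine fun v w => Relation.ReflTransGen.mono ?_ _ _ (h v w)
  rintro x y ⟨i, hx, hy⟩
  exact ⟨σ.symm i, by simpa [Inc, OpenGraph.comapEdges] using hx,
    by simpa [Inc, OpenGraph.comapEdges] using hy⟩

end OpenGraph

/-! ### Recovering the edge lengths from the closed walk lengths -/

namespace MetricOpenGraph

variable {V I E V' I' E' : Type*}

theorem RationallyIndependent.eq_of_sum_eq [Fintype I] {G : MetricOpenGraph V I E}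
    (h : G.RationallyIndependent) {m n : I → ℤ}
    (e : ∑ i, (m i : ℝ) * G.len i = ∑ i, (n i : ℝ) * G.len i) : m = n := by
  funext i
  have := h (fun i => m i - n i) (by simp [sub_mul, e]) i
  simpa [sub_eq_zero] using this

theorem sum_map_len_eq [Fintype I] [DecidableEq I] (G : MetricOpenGraph V I E) (l : List I) :
    (l.map G.len).sum = ∑ i, ((l.count i : ℤ) : ℝ) * G.len i := by
  induction l with
  | nil => simp
  | cons j l ih =>
    simp only [List.map_cons, List.sum_cons, ih, List.count_cons, Nat.cast_add, Int.cast_add,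
      add_mul, Finset.sum_add_distrib]
    simp [add_comm]

theorem RationallyIndependent.perm [Fintype I] {G : MetricOpenGraph V I E}
    (h : G.RationallyIndependent) {l₁ l₂ : List I}
    (e : (l₁.map G.len).sum = (l₂.map G.len).sum) : l₁.Perm l₂ := by
  classical
  rw [sum_map_len_eq, sum_map_len_eq] at e
  rw [List.perm_iff_count]
  intro i
  exact_mod_cast congrFun (h.eq_of_sum_eq e) i

theorem RationallyIndependent.len_injective [Fintype I] {G : MetricOpenGraph V I E}
    (h : G.RationallyIndependent) : Function.Injective G.len := by
  intro i j hij
  have := h.perm (l₁ := [i]) (l₂ := [j]) (by simpa using hij)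
  simpa using this

/-- The directions of the rays of which all integral points lie in a set closed under addition. -/
def recession (L : AddSubmonoid ℝ) : AddSubmonoid ℝ where
  carrier := {d | ∃ s, ∀ k : ℕ, s + k * d ∈ L}
  zero_mem' := ⟨0, by simp⟩
  add_mem' := by
    rintro a b ⟨s, hs⟩ ⟨t, ht⟩
    refine ⟨s + t, fun k => ?_⟩
    have := L.add_mem (hs k) (ht k)
    convert this using 1
    ring

/-- The lengths of the closed walks at an external edge form a monoid. -/
def closedLengths (G : MetricOpenGraph V I E) (e : E) : AddSubmonoid ℝ where
  carrier := G.walkLengths e e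
  zero_mem' := ⟨[], rfl, by simp⟩
  add_mem' := by
    rintro _ _ ⟨l₁, h₁, rfl⟩ ⟨l₂, h₂, rfl⟩
    exact ⟨l₁ ++ l₂, OpenGraph.Joins.append h₁ h₂, by simp⟩

/-- `x` is the primitive element of an extremal ray of the monoid `D`, of which half is missing. -/
def IsExtremal (D : AddSubmonoid ℝ) (x : ℝ) : Prop :=
  x ∈ D ∧ x ≠ 0 ∧ ∀ y ∈ D, ∀ z ∈ D, y + z = 2 * x → y = 0 ∨ y = x ∨ z = 0

section Recession

variable {G : MetricOpenGraph V I E}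

/-- Walk to `i`, run back and forth on it `k` times, return. -/
theorem two_mul_len_mem (hc : G.Connected) (hG : G.NoTadpoles) (e : E) (i : I) :
    2 * G.len i ∈ recession (G.closedLengths e) := by
  obtain ⟨l, hl⟩ := hc.exists_joins hG (G.bd e) (G.init i)
  have hstep : G.Joins (G.init i) [i, i] (G.init i) :=
    (OpenGraph.joins_singleton hG (G.inc_init i) (G.inc_term i) (hG i)).append
      (OpenGraph.joins_singleton hG (G.inc_term i) (G.inc_init i) (Ne.symm (hG i)))
  refine ⟨2 * (l.map G.len).sum, fun k => ?_⟩
  obtain ⟨w, hw, hs⟩ : ∃ w, G.Joins (G.init i) w (G.init i) ∧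
      (w.map G.len).sum = k * (2 * G.len i) := by
    induction k with
    | zero => exact ⟨[], rfl, by simp⟩
    | succ k ih =>
      obtain ⟨w, hw, hs⟩ := ih
      refine ⟨_, hw.append hstep, ?_⟩
      simp [hs]
      ring
  refine ⟨_, hl.append (hw.append hl.reverse), ?_⟩
  simp [hs, List.sum_reverse]
  ring

theorem exists_nat_of_mem_recession [Fintype I] (hind : G.RationallyIndependent) {e : E} {x : ℝ}
    (hx : x ∈ recession (G.closedLengths e)) : ∃ n : I → ℕ, x = ∑ i, (n i : ℝ) * G.len i := by
  classical
  obtain ⟨s, hs⟩ := hx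
  choose l hl e using hs
  have e₀ := e 0
  have e₁ := e 1
  simp only [sum_map_len_eq] at e e₀ e₁
  set d : I → ℤ := fun i => (l 1).count i - (l 0).count i with hd
  have hxd : x = ∑ i, (d i : ℝ) * G.len i := by
    simp only [hd, Int.cast_sub, sub_mul, Finset.sum_sub_distrib, ← e₀, ← e₁]
    simp
  -- Edge multiplicities are affine in `k` with slope `d`; a negative slope would make one of them
  -- negative for large `k`.
  have hk : ∀ (k : ℕ) (i : I), ((l k).count i : ℤ) = (l 0).count i + k * d i := by
    intro k
    refine congrFun (hind.eq_of_sum_eq ?_)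
    simp only [Int.cast_add, Int.cast_mul, add_mul, Finset.sum_add_distrib, mul_assoc,
      ← Finset.mul_sum, ← hxd, ← e]
    simp
  have hnn : ∀ i, 0 ≤ d i := by
    intro i
    by_contra! hneg
    have := hk ((l 0).count i + 1) i
    push_cast at this
    nlinarith
  refine ⟨fun i => (d i).toNat, hxd.trans (Finset.sum_congr rfl fun i _ => ?_)⟩
  have : ((d i).toNat : ℤ) = d i := Int.toNat_of_nonneg (hnn i)
  congr 1
  exact_mod_cast this.symm

/-- Two consecutive closed walks on the ray would differ by one passage through `i`, making the
single edge `i` a cycle modulo two. -/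
theorem len_notMem_recession [Fintype I] (hG : G.NoTadpoles) (hind : G.RationallyIndependent)
    (e : E) (i : I) : G.len i ∉ recession (G.closedLengths e) := by
  rintro ⟨s, hs⟩
  obtain ⟨l₀, h₀, e₀⟩ := hs 0
  obtain ⟨l₁, h₁, e₁⟩ := hs 1
  have hp : l₁.Perm (i :: l₀) := hind.perm (by
    rw [← e₁, List.map_cons, List.sum_cons, ← e₀]
    simp [add_comm])
  have hb := OpenGraph.Joins.boundary_parity hG h₁
  rw [OpenGraph.parity_perm hp, OpenGraph.parity_cons, map_add,
    OpenGraph.Joins.boundary_parity hG h₀, OpenGraph.finsupp_zmod_two_add_self,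
    OpenGraph.boundary_single (G.inc_init i) (G.inc_term i) (hG i), add_zero,
    OpenGraph.single_add_single_eq_zero_iff] at hb
  exact hG i hb

theorem isExtremal_recession_iff [Fintype I] (hc : G.Connected) (hG : G.NoTadpoles)
    (hind : G.RationallyIndependent) (e : E) (x : ℝ) :
    IsExtremal (recession (G.closedLengths e)) x ↔ ∃ i, 2 * G.len i = x := by
  classical
  constructor
  · rintro ⟨hx, hx0, hext⟩
    obtain ⟨n, hn⟩ := exists_nat_of_mem_recession hind hx
    obtain ⟨i, hi⟩ : ∃ i, n i ≠ 0 := by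
      by_contra! h
      exact hx0 (by simp [hn, h])
    -- Doubling `x` makes all coefficients even, so removing `2 * G.len i` leaves a sum of doubled
    -- lengths.
    have hz : 2 * x - 2 * G.len i ∈ recession (G.closedLengths e) := by
      have hsum : 2 * x - 2 * G.len i =
          ∑ j, (n j - if j = i then 1 else 0) • (2 * G.len j) := by
        have h1 : ∀ j, ((n j - if j = i then 1 else 0 : ℕ) : ℝ) =
            n j - if j = i then 1 else 0 := by
          intro j
          split_ifs with h
          · subst h
            rw [Nat.cast_sub (Nat.one_le_iff_ne_zero.2 hi)]
            simp
          · simp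
        simp only [nsmul_eq_mul, h1, sub_mul, Finset.sum_sub_distrib]
        rw [hn, Finset.mul_sum]
        simp [mul_left_comm]
      rw [hsum]
      exact sum_mem fun j _ => nsmul_mem (two_mul_len_mem hc hG e j) _
    rcases hext _ (two_mul_len_mem hc hG e i) _ hz (by ring) with h | h | h
    · exact absurd h (by have := G.len_pos i; positivity)
    · exact ⟨i, h⟩
    · refine absurd hx ?_
      rw [show x = G.len i by linarith]
      exact len_notMem_recession hG hind e i
  · rintro ⟨i, rfl⟩
    have hpos := G.len_pos i
    refine ⟨two_mul_len_mem hc hG e i, by positivity, fun y hy z hz hyz => ?_⟩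
    obtain ⟨n, hn⟩ := exists_nat_of_mem_recession hind hy
    obtain ⟨m, hm⟩ := exists_nat_of_mem_recession hind hz
    have hnm : (fun j => (n j : ℤ) + m j) = fun j => if j = i then 4 else 0 := by
      refine hind.eq_of_sum_eq ?_
      simp only [Int.cast_add, add_mul, Finset.sum_add_distrib, Int.cast_natCast, ← hn, ← hm, hyz]
      simp
      ring
    have hi : n i + m i = 4 := by
      have := congrFun hnm i
      simp only [if_true] at this
      exact_mod_cast this
    have hj : ∀ j, j ≠ i → n j = 0 ∧ m j = 0 := by
      intro j hj
      have := congrFun hnm j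
      simp only [hj, if_false] at this
      omega
    have hy' : y = n i * G.len i := by
      rw [hn]
      exact Finset.sum_eq_single i (fun j _ h => by simp [hj j h]) (by simp)
    have hz' : z = m i * G.len i := by
      rw [hm]
      exact Finset.sum_eq_single i (fun j _ h => by simp [hj j h]) (by simp)
    have hni : n i ≠ 1 := fun h =>
      len_notMem_recession hG hind e i (by simpa [hy', h] using hy)
    have hmi : m i ≠ 1 := fun h =>
      len_notMem_recession hG hind e i (by simpa [hz', h] using hz)
    -- The coefficients sum to 4 and neither is 1, which also excludes 3.
    have hcases : n i = 0 ∨ n i = 2 ∨ m i = 0 := by omega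
    rcases hcases with h | h | h
    · exact Or.inl (by simp [hy', h])
    · exact Or.inr (Or.inl (by simp [hy', h]))
    · exact Or.inr (Or.inr (by simp [hz', h]))

end Recession

/-- The closed walk lengths determine the set of edge lengths. -/
theorem range_len_eq [Fintype I] [Fintype I'] {G : MetricOpenGraph V I E}
    {G' : MetricOpenGraph V' I' E'} (hc : G.Connected) (hc' : G'.Connected) (hG : G.NoTadpoles)
    (hG' : G'.NoTadpoles) (hind : G.RationallyIndependent) (hind' : G'.RationallyIndependent)
    {e : E} {e' : E'} (hL : G.closedLengths e = G'.closedLengths e') :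
    Set.range G.len = Set.range G'.len := by
  ext x
  have h := isExtremal_recession_iff hc hG hind e (2 * x)
  rw [hL, isExtremal_recession_iff hc' hG' hind' e'] at h
  simpa using h.symm

end MetricOpenGraph

/-! ### Assembling the isomorphism -/

theorem theorem1
    {V I E V' I' E' : Type*}
    [Finite V] [Fintype I] [Finite E] [Finite V'] [Fintype I'] [Finite E']
    (G : MetricOpenGraph V I E) (G' : MetricOpenGraph V' I' E')
    (hconn : G.Connected) (hconn' : G'.Connected)
    (htad : G.NoTadpoles) (htad' : G'.NoTadpoles)
    (hind : G.RationallyIndependent) (hind' : G'.RationallyIndependent)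
    (e : E) (e' : E')
    (hL : G.walkLengths e e = G'.walkLengths e' e') :
    ∃ φ : MetricOpenGraph.Iso G.interior G'.interior, φ.onV (G.bd e) = G'.bd e' := by
  have hC : G.closedLengths e = G'.closedLengths e' := SetLike.coe_injective hL
  have hrange := MetricOpenGraph.range_len_eq hconn hconn' htad htad' hind hind' hC
  -- Lengths are injective with equal ranges, so edges are matched by length.
  let σ : I ≃ I' := (Equiv.ofInjective _ hind.len_injective).trans
    ((Equiv.setCongr hrange).trans (Equiv.ofInjective _ hind'.len_injective).symm)
  have hσ : ∀ i, G'.len (σ i) = G.len i := fun i =>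
    congrArg Subtype.val ((Equiv.ofInjective _ hind'.len_injective).apply_symm_apply _)
  have hσ' : ∀ i, G.len (σ.symm i) = G'.len i := fun i => by rw [← hσ, σ.apply_symm_apply]
  let H : OpenGraph V' I E' := G'.toOpenGraph.comapEdges σ
  have hH : H.NoTadpoles := fun i => htad' (σ i)
  have hHc : H.Connected := hconn'.comapEdges σ
  have hS : OpenGraph.ClosedWalksPerm G.toOpenGraph (G.bd e) H (G'.bd e') := by
    intro l hl
    obtain ⟨l', h', hlen⟩ : (l.map G.len).sum ∈ G'.walkLengths e' e' := hL ▸ ⟨l, hl, rfl⟩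
    refine ⟨l'.map σ.symm, OpenGraph.joins_comapEdges.2 (by simpa [OpenGraph.IsWalk] using h'), hind.perm ?_⟩
    simpa [Function.comp_def, hσ'] using hlen.symm
  have hS' : OpenGraph.ClosedWalksPerm H (G'.bd e') G.toOpenGraph (G.bd e) := by
    intro l hl
    have hmem : ((l.map σ).map G'.len).sum ∈ G.walkLengths e e :=
      hL ▸ ⟨l.map σ, OpenGraph.joins_comapEdges.1 hl, rfl⟩
    obtain ⟨l', h', hlen⟩ := hmem
    refine ⟨l', h', hind.perm ?_⟩
    simpa [Function.comp_def, hσ] using hlen.symm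
  obtain ⟨φ, hr, hends⟩ := OpenGraph.exists_equiv hS hS' hconn hHc htad hH
  exact ⟨⟨φ, σ, Equiv.refl _, hends, fun x => x.elim, hσ⟩, hr⟩
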